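/- By a semigroup variety we mean a class of semigroups consisting of all semigroups that satisfy a given system of identities $\mathbf u\approx\mathbf v$, where $\mathbf u,\mathbf v$ are non-empty words over the countably infinite alphabet $\{x_1,x_2,\dots\}$. Let $\mathbb{SEM}$ be the lattice of all semigroup varieties, ordered by inclusion. An element $x$ of a lattice $\langle L;\vee,\wedge\rangle$ is called cancellable if, for all $y,z\in L$, the equalities $x\vee y=x\vee z$ and $x\wedge y=x\wedge z$ imply $y=z$. For a semigroup variety $\mathbf V$ and a positive integer $n$, let $\mathrm{Perm}_n(\mathbf V)$ be the set of all permutations $\pi$ in the symmetric group $S_n$ on $\{1,\dots,n\}$ such that every semigroup in $\mathbf V$ satisfies the identity $x_1x_2\cdots x_n\approx x_{1\pi}x_{2\pi}\cdots x_{n\pi}$, where $i\pi$ denotes the image of $i$ under $\pi$; this set is a subgroup of $S_n$. **Proposition 3.2.** If a semigroup variety $\mathbf V$ is a cancellable element of the lattice $\mathbb{SEM}$ and $n$ is a positive integer, then the group $\mathrm{Perm}_n(\mathbf V)$ is a cancellable element of the lattice $\mathrm{Sub}(S_n)$ of all subgroups of $S_n$. -/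

import Mathlib

universe u

/-- An element `x` of a lattice is cancellable if `x ⊔ y = x ⊔ z` and `x ⊓ y = x ⊓ z` imply
`y = z`. -/
def IsCancellableElement {L : Type*} [Lattice L] (x : L) : Prop :=
  ∀ y z : L, x ⊔ y = x ⊔ z → x ⊓ y = x ⊓ z → y = z

/-- Semigroup words over the countably infinite alphabet `x 0, x 1, x 2, …`. -/
abbrev SemigroupWord : Type := FreeSemigroup ℕ

/-- The semigroup `S` satisfies the identity `a ≈ b`: both words take the same value under every
substitution of elements of `S` for the letters. -/
def SatisfiesIdentity (S : Type*) [Semigroup S] (a b : SemigroupWord) : Prop :=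
  ∀ φ : ℕ → S, FreeSemigroup.lift φ a = FreeSemigroup.lift φ b

/-- The class of all semigroups satisfying every identity of a given system. -/
def semigroupModels (E : Set (SemigroupWord × SemigroupWord)) : Set Semigrp.{u} :=
  {S | ∀ p ∈ E, SatisfiesIdentity S p.1 p.2}

/-- A semigroup variety: a class of semigroups that is given by some system of identities. -/
@[ext]
structure SemigroupVariety where
  carrier : Set Semigrp.{u}
  exists_identities : ∃ E : Set (SemigroupWord × SemigroupWord), carrier = semigroupModels E

namespace SemigroupVariety

/-- The variety `V` satisfies the identity `a ≈ b`: all its members do. -/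
def Satisfies (V : SemigroupVariety.{u}) (a b : SemigroupWord) : Prop :=
  ∀ S ∈ V.carrier, SatisfiesIdentity S a b

/-- The variety given by a system of identities. -/
def ofIdentities (E : Set (SemigroupWord × SemigroupWord)) : SemigroupVariety.{u} :=
  ⟨semigroupModels E, E, rfl⟩

/-- Semigroup varieties are ordered by inclusion of classes. -/
instance : PartialOrder SemigroupVariety.{u} :=
  PartialOrder.lift carrier (fun _ _ h => SemigroupVariety.ext h)

theorem le_iff {V W : SemigroupVariety.{u}} : V ≤ W ↔ V.carrier ⊆ W.carrier := Iff.rfl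

/-- The lattice of all semigroup varieties. The order is inclusion, the meet is the
intersection, and the join is the variety given by all identities that hold in both varieties,
which is the least variety containing both. -/
instance : Lattice SemigroupVariety.{u} where
  sup V W := ofIdentities {p | V.Satisfies p.1 p.2 ∧ W.Satisfies p.1 p.2}
  inf V W :=
    ⟨V.carrier ∩ W.carrier, by
      obtain ⟨E, hE⟩ := V.exists_identities
      obtain ⟨F, hF⟩ := W.exists_identities
      refine ⟨E ∪ F, ?_⟩
      rw [hE, hF]
      ext S
      constructor
      · rintro ⟨h₁, h₂⟩ p (hp | hp)
        · exact h₁ p hp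
        · exact h₂ p hp
      · intro h
        exact ⟨fun p hp => h p (Or.inl hp), fun p hp => h p (Or.inr hp)⟩⟩
  le_sup_left V W := fun S hS _ hp => hp.1 S hS
  le_sup_right V W := fun S hS _ hp => hp.2 S hS
  sup_le V W U hV hW := by
    obtain ⟨E, hE⟩ := U.exists_identities
    intro S hS
    rw [hE]
    intro p hp
    refine hS p ⟨fun R hR => ?_, fun R hR => ?_⟩
    · have h := hV hR
      rw [hE] at h
      exact h p hp
    · have h := hW hR
      rw [hE] at h
      exact h p hp
  inf_le_left V W := fun _ hS => hS.1
  inf_le_right V W := fun _ hS => hS.2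
  le_inf V W U h₁ h₂ := fun _ hS => ⟨h₁ hS, h₂ hS⟩

end SemigroupVariety

/-- The word `x (π 0) x (π 1) ⋯ x (π (n - 1))` of length `n ≥ 1`; the letters `x₁, …, xₙ` are
numbered from `0` here. -/
def permutedWord {n : ℕ} [NeZero n] (π : Equiv.Perm (Fin n)) : SemigroupWord :=
  ⟨(π 0 : ℕ), (List.ofFn fun i => (π i : ℕ)).tail⟩

/-- Renaming the letter `x i` to `x (σ i)` for `i < n` in a permuted linear word. -/
theorem lift_permutedWord {S : Type*} [Semigroup S] {n : ℕ} [NeZero n]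
    (σ π : Equiv.Perm (Fin n)) (φ : ℕ → S) :
    FreeSemigroup.lift (fun k => if h : k < n then φ (σ ⟨k, h⟩ : ℕ) else φ k) (permutedWord π) =
      FreeSemigroup.lift φ (permutedWord (σ * π)) := by
  obtain ⟨m, rfl⟩ := Nat.exists_eq_succ_of_ne_zero (NeZero.ne n)
  have key : ∀ (ψ : ℕ → S) (w : SemigroupWord),
      FreeSemigroup.lift ψ w = (w.tail.map ψ).foldl (· * ·) (ψ w.head) := by
    intro ψ w
    simp [FreeSemigroup.lift, List.foldl_map]
  rw [key, key]
  simp only [permutedWord, List.ofFn_succ, List.tail_cons, List.map_ofFn]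
  congr 1
  · simp [Nat.le_of_lt_succ (π 0).isLt]
  · congr 1
    funext i
    simp [Nat.le_of_lt_succ (π i.succ).isLt]

/-- `Perm n V`: the group of all permutations `π` of `n` letters such that the variety `V`
satisfies the identity `x₁ x₂ ⋯ xₙ ≈ x_{π 1} x_{π 2} ⋯ x_{π n}`. -/
def SemigroupVariety.permGroup (V : SemigroupVariety.{u}) (n : ℕ) [NeZero n] :
    Subgroup (Equiv.Perm (Fin n)) where
  carrier := {π | V.Satisfies (permutedWord 1) (permutedWord π)}
  one_mem' := fun _ _ _ => rfl
  mul_mem' := by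
    intro π σ hπ hσ S hS φ
    have h := hσ S hS (fun k => if h : k < n then φ (π ⟨k, h⟩ : ℕ) else φ k)
    rw [lift_permutedWord, lift_permutedWord, mul_one] at h
    exact (hπ S hS φ).trans h
  inv_mem' := by
    intro π hπ S hS φ
    have h := hπ S hS (fun k => if h : k < n then φ (π⁻¹ ⟨k, h⟩ : ℕ) else φ k)
    rw [lift_permutedWord, lift_permutedWord, mul_one, inv_mul_cancel] at h
    exact h.symm

/-! Each subgroup `X` of the symmetric group is encoded by a variety `linearVariety X`: words longer
than `n` or with a repeated letter are all identified, and linear words of length `n` are identified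
along `X`. These identifications form a fully invariant congruence (`linearCon_lift`), so no further
identities follow and `X` is recovered (`permGroup_linearVariety`). Write `P` for the permutation
group of `V`. The meet of `V` with `linearVariety X` depends only on `P ⊔ X`, and the join only on
`P ⊓ X` (`inf_linearVariety_le`, `sup_linearVariety_le`). Cancelling `V` therefore cancels `P`. -/

namespace FreeSemigroup

variable {α β : Type*}

/-! ### Words as lists of letters -/

/-- The list of letters of a semigroup word. -/
def letters (w : FreeSemigroup α) : List α := w.head :: w.tail

theorem letters_injective : Function.Injective (letters : FreeSemigroup α → List α) := by
  rintro ⟨a, s⟩ ⟨b, t⟩ h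
  simpa [letters] using h

theorem letters_mul (u v : FreeSemigroup α) : (u * v).letters = u.letters ++ v.letters := rfl

theorem letters_lift (σ : α → FreeSemigroup β) (u : FreeSemigroup α) :
    (lift σ u).letters = u.letters.flatMap fun a => (σ a).letters := by
  induction u using FreeSemigroup.recOnMul with
  | ih1 a => simp [letters]
  | ih2 a y _ ih =>
    rw [map_mul, letters_mul, letters_mul, ih, lift_of, List.flatMap_append]
    simp [letters]

theorem one_le_length_letters (u : FreeSemigroup α) : 1 ≤ u.letters.length := by
  simp [letters]

/-- The word `f 0 f 1 ⋯ f (n - 1)` of length `n ≥ 1`. -/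
def ofFn {n : ℕ} [NeZero n] (f : Fin n → α) : FreeSemigroup α :=
  ⟨f 0, (List.ofFn f).tail⟩

theorem letters_ofFn {n : ℕ} [NeZero n] (f : Fin n → α) : (ofFn f).letters = List.ofFn f := by
  obtain ⟨m, rfl⟩ := Nat.exists_eq_succ_of_ne_zero (NeZero.ne n)
  simp [letters, ofFn, List.ofFn_succ]

theorem ofFn_injective {n : ℕ} [NeZero n] :
    Function.Injective (ofFn : (Fin n → α) → FreeSemigroup α) := by
  intro f g h
  have := congrArg letters h
  rwa [letters_ofFn, letters_ofFn, List.ofFn_inj] at this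

theorem lift_eq_lift_of_map_letters_eq {S : Type*} [Semigroup S] {φ : α → S} {ψ : β → S}
    {u : FreeSemigroup α} {v : FreeSemigroup β} (h : u.letters.map φ = v.letters.map ψ) :
    lift φ u = lift ψ v := by
  obtain ⟨a, s⟩ := u
  obtain ⟨b, t⟩ := v
  simp only [letters, List.map_cons, List.cons.injEq] at h
  rw [lift_mk_eq_foldl, lift_mk_eq_foldl, ← List.foldl_map (f := φ) (g := (· * ·)), h.1, h.2,
    List.foldl_map]

theorem lift_ofFn_congr {S : Type*} [Semigroup S] {n : ℕ} [NeZero n] {φ : α → S} {ψ : β → S}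
    {f : Fin n → α} {g : Fin n → β} (h : ∀ i, φ (f i) = ψ (g i)) :
    lift φ (ofFn f) = lift ψ (ofFn g) := by
  apply lift_eq_lift_of_map_letters_eq
  rw [letters_ofFn, letters_ofFn, List.map_ofFn, List.map_ofFn]
  exact congrArg List.ofFn (funext h)

theorem lift_of_comp_ofFn {n : ℕ} [NeZero n] {σ : α → FreeSemigroup β}
    {f : Fin n → α} {g : Fin n → β} (h : ∀ i, σ (f i) = of (g i)) :
    lift σ (ofFn f) = ofFn g := by
  apply letters_injective
  have h' : ∀ i, (σ (f i)).letters = [g i] := fun i => by rw [h i]; rfl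
  rw [letters_lift, letters_ofFn, letters_ofFn, List.flatMap_def, List.map_ofFn]
  simp [Function.comp_def, h', List.ofFn_eq_map, ← List.flatMap_def]
  simp [List.map_eq_flatMap]

/-! ### The ideal of long or nonlinear words -/

/-- Words that have more than `n` letters or a repeated letter. -/
def IsLongOrNonlinear (n : ℕ) (u : FreeSemigroup α) : Prop :=
  n < u.letters.length ∨ ¬ u.letters.Nodup

theorem IsLongOrNonlinear.mul_right {n : ℕ} {u : FreeSemigroup α} (h : u.IsLongOrNonlinear n)
    (v : FreeSemigroup α) : (u * v).IsLongOrNonlinear n := by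
  rw [IsLongOrNonlinear, letters_mul, List.length_append]
  exact h.imp (fun h => by omega) fun h h' => h h'.of_append_left

theorem IsLongOrNonlinear.mul_left {n : ℕ} {u : FreeSemigroup α} (h : u.IsLongOrNonlinear n)
    (v : FreeSemigroup α) : (v * u).IsLongOrNonlinear n := by
  rw [IsLongOrNonlinear, letters_mul, List.length_append]
  exact h.imp (fun h => by omega) fun h h' => h h'.of_append_right

/-- Substituted blocks are nonempty, so length cannot drop, and a repeated letter yields a repeated
block, hence a repeated letter. -/
theorem IsLongOrNonlinear.lift {n : ℕ} {u : FreeSemigroup α} (h : u.IsLongOrNonlinear n)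
    (σ : α → FreeSemigroup β) : (lift σ u).IsLongOrNonlinear n := by
  rw [IsLongOrNonlinear, letters_lift]
  refine h.imp (fun h => h.trans_le ?_) fun h h' => h ?_
  · rw [List.length_flatMap]
    simpa using List.card_nsmul_le_sum (u.letters.map fun a => (σ a).letters.length) 1
      (by simpa using fun a _ => one_le_length_letters (σ a))
  · refine (List.nodup_flatMap.1 h').2.imp ?_
    rintro a b hab rfl
    exact hab (List.mem_cons_self : (σ a).head ∈ _) List.mem_cons_self

theorem not_isLongOrNonlinear_ofFn {n : ℕ} [NeZero n] {f : Fin n → α}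
    (hf : Function.Injective f) : ¬ (ofFn f).IsLongOrNonlinear n := by
  rw [IsLongOrNonlinear, letters_ofFn, List.length_ofFn, List.nodup_ofFn]
  simpa using hf

theorem isLongOrNonlinear_ofFn {n : ℕ} [NeZero n] {f : Fin n → α}
    (hf : ¬ Function.Injective f) : (ofFn f).IsLongOrNonlinear n := by
  rw [IsLongOrNonlinear, letters_ofFn, List.nodup_ofFn]
  exact Or.inr hf

theorem isLongOrNonlinear_ofFn_mul {n : ℕ} [NeZero n] (f : Fin n → α) (v : FreeSemigroup α) :
    (ofFn f * v).IsLongOrNonlinear n := by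
  have := one_le_length_letters v
  rw [IsLongOrNonlinear, letters_mul, letters_ofFn, List.length_append, List.length_ofFn]
  omega

theorem isLongOrNonlinear_mul_ofFn {n : ℕ} [NeZero n] (f : Fin n → α) (v : FreeSemigroup α) :
    (v * ofFn f).IsLongOrNonlinear n := by
  have := one_le_length_letters v
  rw [IsLongOrNonlinear, letters_mul, letters_ofFn, List.length_append, List.length_ofFn]
  omega

theorem isLongOrNonlinear_lift_ofFn {n : ℕ} [NeZero n] {f : Fin n → α}
    {σ : α → FreeSemigroup β} {i : Fin n} (hi : 1 < (σ (f i)).letters.length) :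
    (lift σ (ofFn f)).IsLongOrNonlinear n := by
  left
  rw [letters_lift, letters_ofFn, List.length_flatMap, List.map_ofFn, List.sum_ofFn]
  calc n = ∑ _i : Fin n, 1 := by simp
    _ < _ := Finset.sum_lt_sum (fun j _ => one_le_length_letters (σ (f j)))
      ⟨i, Finset.mem_univ i, hi⟩

/-! ### The congruence attached to a subgroup -/

/-- The congruence that identifies all words with more than `n` letters or a repeated letter, and
identifies two linear words of length `n` if they differ by a permutation of the positions that
lies in `X`. -/
def linearCon (α : Type*) {n : ℕ} [NeZero n] (X : Subgroup (Equiv.Perm (Fin n))) :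
    Con (FreeSemigroup α) where
  r u v := u = v ∨ (u.IsLongOrNonlinear n ∧ v.IsLongOrNonlinear n) ∨
    ∃ f : Fin n → α, Function.Injective f ∧ ∃ π ∈ X, u = ofFn f ∧ v = ofFn (f ∘ π)
  iseqv := by
    refine ⟨fun u => Or.inl rfl, ?_, ?_⟩
    · rintro u v (rfl | ⟨hu, hv⟩ | ⟨f, hf, π, hπ, rfl, rfl⟩)
      · exact Or.inl rfl
      · exact Or.inr (Or.inl ⟨hv, hu⟩)
      · refine Or.inr (Or.inr ⟨f ∘ π, hf.comp π.injective, π⁻¹, X.inv_mem hπ, rfl, ?_⟩)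
        congr 1
        funext i
        simp
    · rintro u v w (rfl | ⟨hu, hv⟩ | ⟨f, hf, π, hπ, rfl, rfl⟩) h₂
      · exact h₂
      · obtain rfl | ⟨-, hw⟩ | ⟨g, hg, τ, -, rfl, -⟩ := h₂
        · exact Or.inr (Or.inl ⟨hu, hv⟩)
        · exact Or.inr (Or.inl ⟨hu, hw⟩)
        · exact absurd hv (not_isLongOrNonlinear_ofFn hg)
      · obtain rfl | ⟨hv, -⟩ | ⟨g, hg, τ, hτ, hgf, rfl⟩ := h₂
        · exact Or.inr (Or.inr ⟨f, hf, π, hπ, rfl, rfl⟩)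
        · exact absurd hv (not_isLongOrNonlinear_ofFn (hf.comp π.injective))
        · obtain rfl := ofFn_injective hgf
          exact Or.inr (Or.inr ⟨f, hf, π * τ, X.mul_mem hπ hτ, rfl, rfl⟩)
  mul' := by
    -- Any product with a factor of length `n` is too long, so permuted words cause no new case.
    rintro u v w z (rfl | ⟨hu, hv⟩ | ⟨f, -, π, -, rfl, rfl⟩) h₂
    · obtain rfl | ⟨hw, hz⟩ | ⟨g, -, τ, -, rfl, rfl⟩ := h₂
      · exact Or.inl rfl
      · exact Or.inr (Or.inl ⟨hw.mul_left _, hz.mul_left _⟩)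
      · exact Or.inr (Or.inl ⟨isLongOrNonlinear_mul_ofFn _ _, isLongOrNonlinear_mul_ofFn _ _⟩)
    · exact Or.inr (Or.inl ⟨hu.mul_right _, hv.mul_right _⟩)
    · exact Or.inr (Or.inl ⟨isLongOrNonlinear_ofFn_mul _ _, isLongOrNonlinear_ofFn_mul _ _⟩)

section linearCon

variable {n : ℕ} [NeZero n] {X : Subgroup (Equiv.Perm (Fin n))}

theorem linearCon_iff {u v : FreeSemigroup α} :
    linearCon α X u v ↔ u = v ∨ (u.IsLongOrNonlinear n ∧ v.IsLongOrNonlinear n) ∨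
      ∃ f : Fin n → α, Function.Injective f ∧ ∃ π ∈ X, u = ofFn f ∧ v = ofFn (f ∘ π) :=
  Iff.rfl

/-- Full invariance. On a permuted pair, a substitution that lengthens some letter makes both sides
long; otherwise it renames letters, and both sides become nonlinear unless the renaming is injective
on them. -/
theorem linearCon_lift {u v : FreeSemigroup α} (h : linearCon α X u v)
    (σ : α → FreeSemigroup β) : linearCon β X (lift σ u) (lift σ v) := by
  obtain rfl | ⟨hu, hv⟩ | ⟨f, hf, π, hπ, rfl, rfl⟩ := linearCon_iff.1 h
  · exact Or.inl rfl
  · exact Or.inr (Or.inl ⟨hu.lift σ, hv.lift σ⟩)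
  by_cases hσ : ∃ i, 1 < (σ (f i)).letters.length
  · obtain ⟨i, hi⟩ := hσ
    refine Or.inr (Or.inl ⟨isLongOrNonlinear_lift_ofFn hi,
      isLongOrNonlinear_lift_ofFn (i := π⁻¹ i) ?_⟩)
    simpa using hi
  · have hσ' : ∀ i, σ (f i) = of (σ (f i)).head := by
      intro i
      have : (σ (f i)).tail = [] := by
        by_contra h
        have := List.length_pos_iff.2 h
        exact hσ ⟨i, by simpa [letters] using this⟩
      exact FreeSemigroup.ext rfl this
    rw [lift_of_comp_ofFn hσ', lift_of_comp_ofFn (f := f ∘ π) fun i => hσ' (π i)]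
    by_cases hg : Function.Injective fun i => (σ (f i)).head
    · exact Or.inr (Or.inr ⟨_, hg, π, hπ, rfl, rfl⟩)
    · refine Or.inr (Or.inl ⟨isLongOrNonlinear_ofFn hg, isLongOrNonlinear_ofFn fun h => hg ?_⟩)
      simpa [Function.comp_def] using h.comp (π⁻¹).injective

theorem linearCon_ofFn_comp_iff {f : Fin n → α} (hf : Function.Injective f)
    {π : Equiv.Perm (Fin n)} : linearCon α X (ofFn f) (ofFn (f ∘ π)) ↔ π ∈ X := by
  refine ⟨fun h => ?_, fun h => Or.inr (Or.inr ⟨f, hf, π, h, rfl, rfl⟩)⟩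
  obtain h | ⟨h, -⟩ | ⟨g, hg, τ, hτ, hfg, h⟩ := linearCon_iff.1 h
  · have h' : π = 1 := Equiv.ext fun i => (hf (congrFun (ofFn_injective h) i)).symm
    exact h' ▸ X.one_mem
  · exact absurd h (not_isLongOrNonlinear_ofFn hf)
  · obtain rfl := ofFn_injective hfg
    have h' : π = τ := Equiv.ext fun i => hf (congrFun (ofFn_injective h) i)
    exact h' ▸ hτ

end linearCon

end FreeSemigroup

/-! ### Varieties attached to subgroups -/

/-- A linear permutation identity may be stated with any choice of distinct letters. -/
theorem satisfiesIdentity_ofFn_comp_iff {S : Type*} [Semigroup S] {n : ℕ} [NeZero n]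
    {f : Fin n → ℕ} (hf : Function.Injective f) {π : Equiv.Perm (Fin n)} :
    SatisfiesIdentity S (FreeSemigroup.ofFn f) (FreeSemigroup.ofFn (f ∘ π)) ↔
      SatisfiesIdentity S (permutedWord (1 : Equiv.Perm (Fin n))) (permutedWord π) := by
  have key : ∀ {f g : Fin n → ℕ}, Function.Injective f →
      SatisfiesIdentity S (FreeSemigroup.ofFn f) (FreeSemigroup.ofFn (f ∘ π)) →
      SatisfiesIdentity S (FreeSemigroup.ofFn g) (FreeSemigroup.ofFn (g ∘ π)) := by
    intro f g hf h φ
    have hψ : ∀ i, Function.extend f (φ ∘ g) φ (f i) = φ (g i) := fun i => hf.extend_apply _ _ i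
    have := h (Function.extend f (φ ∘ g) φ)
    rwa [FreeSemigroup.lift_ofFn_congr hψ,
      FreeSemigroup.lift_ofFn_congr (f := f ∘ π) (g := g ∘ π) fun i => hψ (π i)] at this
  exact ⟨key hf, key Fin.val_injective⟩

namespace SemigroupVariety

open FreeSemigroup

theorem satisfies_ofIdentities {E : Set (SemigroupWord × SemigroupWord)} {u v : SemigroupWord}
    (h : (u, v) ∈ E) : (ofIdentities.{u} E).Satisfies u v := fun _ hS => hS _ h

theorem permGroup_antitone {n : ℕ} [NeZero n] {V W : SemigroupVariety.{u}} (h : V ≤ W) :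
    W.permGroup n ≤ V.permGroup n := fun _ hπ S hS => hπ S (h hS)

theorem satisfies_ofFn_comp_iff {V : SemigroupVariety.{u}} {n : ℕ} [NeZero n] {f : Fin n → ℕ}
    (hf : Function.Injective f) {π : Equiv.Perm (Fin n)} :
    V.Satisfies (ofFn f) (ofFn (f ∘ π)) ↔ π ∈ V.permGroup n :=
  forall₂_congr fun _ _ => satisfiesIdentity_ofFn_comp_iff hf

/-- The variety whose identities form the congruence `linearCon ℕ X`. -/
def linearVariety {n : ℕ} [NeZero n] (X : Subgroup (Equiv.Perm (Fin n))) :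
    SemigroupVariety.{u} :=
  ofIdentities {p | linearCon ℕ X p.1 p.2}

variable {n : ℕ} [NeZero n] {X Y : Subgroup (Equiv.Perm (Fin n))}

/-- The relatively free semigroup of `linearVariety X`. -/
theorem quotient_mem_linearVariety :
    Semigrp.of (ULift.{u} (linearCon ℕ X).Quotient) ∈ (linearVariety.{u} X).carrier := by
  rintro ⟨u, v⟩ h φ
  -- Choosing representatives turns an evaluation in the quotient into a substitution of words,
  -- where full invariance applies.
  choose σ hσ using fun k => Quotient.exists_rep (φ k).down
  have hom : ∀ w : SemigroupWord, FreeSemigroup.lift φ w =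
      (ULift.up (FreeSemigroup.lift σ w : (linearCon ℕ X).Quotient) : ULift.{u} _) := by
    intro w
    induction w using FreeSemigroup.recOnMul with
    | ih1 a => exact ULift.ext _ _ (hσ a).symm
    | ih2 a y h₁ h₂ => rw [map_mul, map_mul, h₁, h₂]; rfl
  rw [hom, hom]
  exact congrArg ULift.up ((Con.eq _).2 (linearCon_lift h σ))

/-- Evaluating an identity at the generators of the relatively free semigroup shows that its two
sides are congruent. -/
theorem satisfies_linearVariety_iff {u v : SemigroupWord} :
    (linearVariety.{u} X).Satisfies u v ↔ linearCon ℕ X u v := by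
  refine ⟨fun h => ?_, fun h => satisfies_ofIdentities h⟩
  have hom : ∀ w : SemigroupWord, FreeSemigroup.lift
      (fun k => (ULift.up (FreeSemigroup.of k : (linearCon ℕ X).Quotient) : ULift.{u} _)) w =
      ULift.up ((linearCon ℕ X).toQuotient w) := by
    intro w
    induction w using FreeSemigroup.recOnMul with
    | ih1 a => rfl
    | ih2 a y h₁ h₂ => rw [map_mul, h₁, h₂]; rfl
  have h' := h _ quotient_mem_linearVariety
    fun k => (ULift.up (FreeSemigroup.of k : (linearCon ℕ X).Quotient) : ULift.{u} _)
  rw [← Con.eq]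
  exact congrArg ULift.down (((hom u).symm.trans h').trans (hom v))

theorem permGroup_linearVariety : (linearVariety.{u} X).permGroup n = X := by
  ext π
  exact satisfies_linearVariety_iff.trans (linearCon_ofFn_comp_iff Fin.val_injective)

/-- A semigroup lies in `linearVariety X` if it identifies all words that are longer than `n` or
nonlinear, and satisfies the permutation identities given by `X`. -/
theorem mem_linearVariety {S : Semigrp.{u}}
    (h : ∀ u v : SemigroupWord, u.IsLongOrNonlinear n → v.IsLongOrNonlinear n →
      SatisfiesIdentity S u v)
    (hX : ∀ π ∈ X, SatisfiesIdentity S (permutedWord (1 : Equiv.Perm (Fin n))) (permutedWord π)) :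
    S ∈ (linearVariety.{u} X).carrier := by
  rintro ⟨u, v⟩ huv
  obtain huv | ⟨hu, hv⟩ | ⟨f, hf, π, hπ, hu, hv⟩ := linearCon_iff.1 huv
  · exact fun φ => congrArg _ huv
  · exact h u v hu hv
  · dsimp only at hu hv ⊢
    rw [hu, hv]
    exact (satisfiesIdentity_ofFn_comp_iff hf).2 (hX π hπ)

/-- The meet inherits the permutation identities of both varieties, hence those of the subgroup they
generate. -/
theorem inf_linearVariety_le {V : SemigroupVariety.{u}} (h : X ≤ V.permGroup n ⊔ Y) :
    V ⊓ linearVariety Y ≤ V ⊓ linearVariety X := by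
  refine le_inf inf_le_left fun S hS => mem_linearVariety
    (fun u v hu hv => hS.2 (u, v) (Or.inr (Or.inl ⟨hu, hv⟩))) fun π hπ => ?_
  have hY : V.permGroup n ⊔ Y ≤ (V ⊓ linearVariety Y).permGroup n :=
    sup_le (permGroup_antitone inf_le_left)
      (permGroup_linearVariety.ge.trans (permGroup_antitone inf_le_right))
  exact hY (h hπ) S hS

/-- An identity of the join holds in both varieties; if it is a permutation identity, its
permutation lies in both groups, hence in `Y`. The other kinds do not involve the subgroup. -/
theorem sup_linearVariety_le {V : SemigroupVariety.{u}} (h : V.permGroup n ⊓ X ≤ Y) :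
    V ⊔ linearVariety Y ≤ V ⊔ linearVariety X := by
  refine sup_le le_sup_left ?_
  rintro S hS ⟨u, v⟩ ⟨hV, hX⟩
  refine hS (u, v) ?_
  obtain huv | huv | ⟨f, hf, π, hπ, rfl, rfl⟩ := linearCon_iff.1 (satisfies_linearVariety_iff.1 hX)
  · exact Or.inl huv
  · exact Or.inr (Or.inl huv)
  · exact (linearCon_ofFn_comp_iff hf).2 (h ⟨(satisfies_ofFn_comp_iff hf).1 hV, hπ⟩)

end SemigroupVariety

open SemigroupVariety in
theorem proposition3p2 (V : SemigroupVariety.{u}) (hV : IsCancellableElement V)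
    (n : ℕ) [NeZero n] : IsCancellableElement (V.permGroup n) := by
  intro X Y hsup hinf
  have h : linearVariety.{u} X = linearVariety Y := by
    refine hV _ _ (le_antisymm ?_ ?_) (le_antisymm ?_ ?_)
    · exact sup_linearVariety_le (hinf.ge.trans inf_le_right)
    · exact sup_linearVariety_le (hinf.le.trans inf_le_right)
    · exact inf_linearVariety_le (le_sup_right.trans hsup.ge)
    · exact inf_linearVariety_le (le_sup_right.trans hsup.le)
  rw [← permGroup_linearVariety.{u} (X := X), h, permGroup_linearVariety]
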